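/- Let $d\ge 1$, let $X$ be a random vector in $\mathbb{R}^d$ all of whose components have finite second moment, let $\mu=\mathbb{E}[X]$, let $X_1,X_2,\dots$ be i.i.d. with the distribution of $X$, and put $S_n=X_1+\cdots+X_n$. Let $\mathscr{R}\subseteq\{(t,s): t\ge 0,\ s\in\mathbb{R}^d\}$, let $K$ be a positive integer, and let $$N=\inf\{n\in\{K,2K,3K,\dots\}: (n,S_n)\notin\mathscr{R}\},\qquad \inf\emptyset=\infty .$$ Assume that the closure $\overline{\mathscr{R}}$ is a convex set containing $(0,0)$, and that there is a unique positive number $m$ such that $(m,m\mu)$ lies in the boundary $\partial\mathscr{R}$. Assume that, for some $A\in\mathbb{R}^d$, $B\in\mathbb{R}$ and $C>0$, the hyperplane $\{(t,s): \langle A,s\rangle+Bt=C\}$ is a supporting hyperplane of $\mathscr{R}$ passing through $(m,m\mu)$. Put $Z=BK+\langle A,\sum_{i=1}^K X_i\rangle$ and $Z^+=\max(0,Z)$. Then the following hold. (I) $$\mathbb{E}[N]\le m+\frac1K\Big(\frac mC\Big)^2\mathbb{E}\big[(Z^+)^2\big]\le m+K+\Big(\frac mC\Big)^2\mathbb{E}\big[\langle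 A,X-\mu\rangle^2\big]\le m+K+\Big(\frac mC\Big)^2\|A\|_2^2\,\mathbb{E}\big[\|X-\mu\|_2^2\big].$$ (II) If the components $x_1,\dots,x_d$ of $X$ are mutually independent, then $$\mathbb{E}[N]\le m+K+\Big(\frac mC\Big)^2\sum_{j=1}^d A_j^2\,\mathbb{E}\big[(x_j-\mu_j)^2\big].$$ (III) If $a,b\in\mathbb{R}^d$ are such that, with probability $1$, $a_j\le x_j\le b_j$ for every $j$, then $$\mathbb{E}[N]\le m+\frac{Km(u+v)}{C}-\frac{Km^2uv}{C^2},$$ where $$u=\tfrac12\Big[\sum_j A_j(a_j+b_j)+\sum_j|A_j|(a_j-b_j)\Big]+B,\qquad v=\tfrac12\Big[\sum_j A_j(a_j+b_j)+\sum_j|A_j|(b_j-a_j)\Big]+B .$$ If moreover $u<0$, then $$\mathbb{E}[N]\le m+\frac{Kv^2}{v-u}\Big(\frac mC\Big)^2\Big(\frac Cm-u\Big).$$ -/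

import Mathlib

open MeasureTheory ProbabilityTheory
open scoped ENNReal

/-- The sum `S_n` of the first `n` samples; the samples `X₁, X₂, …` are `ξ 0, ξ 1, …`. -/
noncomputable def sampleSum {d : ℕ} {Ω : Type*} (ξ : ℕ → Ω → EuclideanSpace ℝ (Fin d))
    (n : ℕ) (ω : Ω) : EuclideanSpace ℝ (Fin d) :=
  ∑ i ∈ Finset.range n, ξ i ω

/-- The first positive multiple `n` of `K` with `(n, S_n) ∉ R`, where `R` is the continuity region
in the `(t, s)`-space; it is `⊤` if there is no such `n`. -/
noncomputable def exitTime {d : ℕ} {Ω : Type*} (K : ℕ) (R : Set (ℝ × EuclideanSpace ℝ (Fin d)))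
    (ξ : ℕ → Ω → EuclideanSpace ℝ (Fin d)) (ω : Ω) : ℕ∞ :=
  sInf {N : ℕ∞ | ∃ n : ℕ, N = (n : ℕ∞) ∧ 0 < n ∧ K ∣ n ∧ ((n : ℝ), sampleSum ξ n ω) ∉ R}

/-- The hyperplane `A s + B t = C` in the `(t, s)`-space supports `R` and passes through the point
`p` of the closure of `R`: it is nondegenerate, contains `p`, and `R` lies on one side of it. -/
def IsSupportingHyperplaneAt {d : ℕ} (R : Set (ℝ × EuclideanSpace ℝ (Fin d)))
    (A : EuclideanSpace ℝ (Fin d)) (B C : ℝ) (p : ℝ × EuclideanSpace ℝ (Fin d)) : Prop :=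
  (A ≠ 0 ∨ B ≠ 0) ∧ p ∈ closure R ∧ inner ℝ A p.2 + B * p.1 = C ∧
    ((∀ q ∈ R, inner ℝ A q.2 + B * q.1 ≤ C) ∨ (∀ q ∈ R, C ≤ inner ℝ A q.2 + B * q.1))

/-! Since `C > 0` and the origin lies in the closure of `R`, the region lies in the half-space `⟨A,
s⟩ + B t ≤ C`. Hence `N ≤ K τ`, where `τ` is the first passage over `C` of the walk whose steps are
the block sums of `⟨A, X_i⟩ + B`, distributed as `Z`. As `(m, m μ)` lies on the hyperplane, `E Z = K
C / m`. Lorden's inequality `E τ ≤ (C + E (Z⁺)² / E Z) / E Z` is then the first bound of (I); the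
others only estimate `E (Z⁺)²`.

Lorden's inequality is proved for passage times truncated at `k`, so finiteness of `E τ` is never
needed. Let `t(c)` be the mean truncated passage time, `r(c)` the mean overshoot, `M > 0` the mean
step and `σ` the mean squared positive part of a step. Three facts carry the proof. Subadditivity of
`t`, averaged over `[0, c]`, gives `c t(c) ≤ 2 ∫₀ᶜ t` (`mul_meanPassage_le_integral`). Wald's
identity becomes `M t(c) - c ≤ r(c)` (`mul_meanPassage_sub_le_meanOvershoot`). Pathwise, when the
level is crossed, twice the integral over `[0, c]` of the overshoots plus the square of the last one
is the sum of the squared ladder heights, and each ladder height is at most the positive part of its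
step. In the mean, with Jensen, `2 ∫₀ᶜ r + r(c)² ≤ σ t(c)`
(`two_mul_integral_meanOvershoot_add_sq_le`). Together they give `T (T - c - σ / M) ≤ 0` for `T = M
t(c)` as soon as `T > c`. Monotone convergence in `k` removes the truncation. -/

/-! ### Truncated passage times and overshoots: subadditivity and Wald's inequality -/

/-- For a random walk with step law `ν` started at `0`, the expectation of `min τ k`, where `τ` is
the first time at which the walk exceeds the level `c`. -/
noncomputable def meanPassage (ν : Measure ℝ) : ℕ → ℝ → ℝ
  | 0, _ => 0
  | k + 1, c => if 0 ≤ c then 1 + ∫ y, meanPassage ν k (c - y) ∂ν else 0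

/-- For a random walk with step law `ν` started at `0`, the expectation of the overshoot over the
level `c` on the event that `c` is exceeded by time `k`. -/
noncomputable def meanOvershoot (ν : Measure ℝ) : ℕ → ℝ → ℝ
  | 0, c => if 0 ≤ c then 0 else -c
  | k + 1, c => if 0 ≤ c then ∫ y, meanOvershoot ν k (c - y) ∂ν else -c

lemma meanPassage_of_neg (ν : Measure ℝ) (k : ℕ) {c : ℝ} (hc : c < 0) :
    meanPassage ν k c = 0 := by
  cases k <;> simp [meanPassage, hc]

lemma meanOvershoot_of_neg (ν : Measure ℝ) (k : ℕ) {c : ℝ} (hc : c < 0) :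
    meanOvershoot ν k c = -c := by
  cases k <;> simp [meanOvershoot, hc]

lemma meanPassage_succ (ν : Measure ℝ) (k : ℕ) {c : ℝ} (hc : 0 ≤ c) :
    meanPassage ν (k + 1) c = 1 + ∫ y, meanPassage ν k (c - y) ∂ν := by
  simp [meanPassage, hc]

lemma meanOvershoot_succ (ν : Measure ℝ) (k : ℕ) {c : ℝ} (hc : 0 ≤ c) :
    meanOvershoot ν (k + 1) c = ∫ y, meanOvershoot ν k (c - y) ∂ν := by
  simp [meanOvershoot, hc]

lemma meanOvershoot_nonneg {ν : Measure ℝ} (k : ℕ) (c : ℝ) : 0 ≤ meanOvershoot ν k c := by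
  induction k generalizing c with
  | zero =>
    rcases lt_or_ge c 0 with hc | hc
    · rw [meanOvershoot_of_neg ν _ hc]; linarith
    · simp [meanOvershoot, hc]
  | succ k ih =>
    rcases lt_or_ge c 0 with hc | hc
    · rw [meanOvershoot_of_neg ν _ hc]; linarith
    · rw [meanOvershoot_succ ν _ hc]
      exact integral_nonneg fun y => ih _

section

variable {ν : Measure ℝ} [IsProbabilityMeasure ν]

lemma meanPassage_spec (k : ℕ) :
    Monotone (meanPassage ν k) ∧ ∀ c, 0 ≤ meanPassage ν k c ∧ meanPassage ν k c ≤ k := by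
  induction k with
  | zero => exact ⟨fun _ _ _ => le_rfl, fun c => by simp [meanPassage]⟩
  | succ k ih =>
    obtain ⟨hmono, hb⟩ := ih
    have hint : ∀ c, Integrable (fun y => meanPassage ν k (c - y)) ν := fun c => by
      refine Integrable.of_bound (C := k)
        (hmono.measurable.comp (measurable_const.sub measurable_id)).aestronglyMeasurable
        (ae_of_all _ fun y => ?_)
      rw [Real.norm_of_nonneg (hb _).1]
      exact (hb _).2
    have hnn : ∀ c, 0 ≤ ∫ y, meanPassage ν k (c - y) ∂ν := fun c =>
      integral_nonneg fun y => (hb _).1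
    have hle : ∀ c, ∫ y, meanPassage ν k (c - y) ∂ν ≤ k := fun c => by
      simpa using integral_mono (hint c) (integrable_const (k : ℝ)) fun y => (hb _).2
    refine ⟨fun a b hab => ?_, fun c => ?_⟩
    · rcases lt_or_ge a 0 with ha | ha
      · rw [meanPassage_of_neg ν _ ha]
        rcases lt_or_ge b 0 with hb' | hb'
        · rw [meanPassage_of_neg ν _ hb']
        · rw [meanPassage_succ ν _ hb']
          linarith [hnn b]
      · rw [meanPassage_succ ν _ ha, meanPassage_succ ν _ (ha.trans hab)]
        gcongr
        · exact hint a
        · exact hint b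
        · intro y
          exact hmono (by linarith)
    · push_cast
      rcases lt_or_ge c 0 with hc | hc
      · rw [meanPassage_of_neg ν _ hc]
        exact ⟨le_rfl, by positivity⟩
      · rw [meanPassage_succ ν _ hc]
        exact ⟨by linarith [hnn c], by linarith [hle c]⟩

lemma meanPassage_mono (k : ℕ) : Monotone (meanPassage ν k) := (meanPassage_spec k).1

lemma meanPassage_nonneg (k : ℕ) (c : ℝ) : 0 ≤ meanPassage ν k c := ((meanPassage_spec k).2 c).1

lemma integrable_meanPassage (k : ℕ) (c : ℝ) :
    Integrable (fun y => meanPassage ν k (c - y)) ν := by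
  refine Integrable.of_bound (C := k)
    ((meanPassage_mono k).measurable.comp (measurable_const.sub measurable_id)).aestronglyMeasurable
    (ae_of_all _ fun y => ?_)
  rw [Real.norm_of_nonneg (meanPassage_nonneg _ _)]
  exact ((meanPassage_spec k).2 _).2

/-- Once `b` is passed, at most `c` remains to be climbed. The level `b` ranges over all reals
because the induction replaces it by `b - y`; for negative `b` monotonicity suffices. -/
lemma meanPassage_add_le (k : ℕ) (b : ℝ) {c : ℝ} (hc : 0 ≤ c) :
    meanPassage ν k (b + c) ≤ meanPassage ν k b + meanPassage ν k c := by
  induction k generalizing b with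
  | zero => simp [meanPassage]
  | succ k ih =>
    rcases lt_or_ge b 0 with hb | hb
    · rw [meanPassage_of_neg ν _ hb, zero_add]
      exact meanPassage_mono _ (by linarith)
    -- The induction step leaves `meanPassage ν k c`, with one step less than the claim allows;
    -- monotonicity in the truncation absorbs this.
    · have hle : ∀ b, meanPassage ν k (b) ≤ meanPassage ν (k + 1) b := by
        clear ih hb
        induction k with
        | zero => intro b; simpa [meanPassage] using meanPassage_nonneg (ν := ν) 1 b
        | succ k ih =>
          intro b
          rcases lt_or_ge b 0 with hb | hb
          · rw [meanPassage_of_neg ν _ hb, meanPassage_of_neg ν _ hb]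
          · rw [meanPassage_succ ν _ hb, meanPassage_succ ν _ hb]
            gcongr
            · exact integrable_meanPassage _ _
            · exact integrable_meanPassage _ _
            · intro y; exact ih _
      rw [meanPassage_succ ν _ (add_nonneg hb hc), meanPassage_succ ν _ hb]
      have h1 : ∫ y, meanPassage ν k (b + c - y) ∂ν ≤
          ∫ y, (meanPassage ν k (b - y) + meanPassage ν k c) ∂ν := by
        refine integral_mono (integrable_meanPassage _ _)
          ((integrable_meanPassage _ _).add (integrable_const _)) fun y => ?_
        have := ih (b - y)
        rwa [show b - y + c = b + c - y by ring] at this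
      rw [integral_add (integrable_meanPassage _ _) (integrable_const _)] at h1
      simp only [integral_const, probReal_univ, one_smul] at h1
      linarith [hle c]

lemma mul_meanPassage_le_integral (k : ℕ) {c : ℝ} (hc : 0 ≤ c) :
    c * meanPassage ν k c ≤ 2 * ∫ b in (0 : ℝ)..c, meanPassage ν k b := by
  have hi : ∀ a b : ℝ, IntervalIntegrable (meanPassage ν k) volume a b := fun a b =>
    (meanPassage_mono k).intervalIntegrable
  have hi' : IntervalIntegrable (fun b => meanPassage ν k (c - b)) volume 0 c := by
    have := (hi c 0).comp_sub_left c
    simpa using this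
  have h1 : ∫ b in (0 : ℝ)..c, meanPassage ν k c ≤
      ∫ b in (0 : ℝ)..c, (meanPassage ν k (c - b) + meanPassage ν k b) := by
    refine intervalIntegral.integral_mono_on hc (by simp) (hi'.add (hi 0 c)) fun b hb => ?_
    simpa using meanPassage_add_le (ν := ν) k (c - b) hb.1
  rw [intervalIntegral.integral_add hi' (hi 0 c), intervalIntegral.integral_comp_sub_left
    (fun b => meanPassage ν k b)] at h1
  simp only [intervalIntegral.integral_const, smul_eq_mul, sub_zero, sub_self] at h1
  linarith

lemma measurable_meanOvershoot (k : ℕ) : Measurable (meanOvershoot ν k) := by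
  induction k with
  | zero =>
    exact Measurable.ite measurableSet_Ici measurable_const measurable_neg
  | succ k ih =>
    refine Measurable.ite measurableSet_Ici ?_ measurable_neg
    have h : StronglyMeasurable (Function.uncurry fun c y : ℝ => meanOvershoot ν k (c - y)) :=
      (ih.comp (measurable_fst.sub measurable_snd)).stronglyMeasurable
    exact h.integral_prod_right.measurable

/-- A crude linear growth bound, each step adding at most its absolute value; it serves only
integrability. -/
lemma meanOvershoot_le (h1 : Integrable (fun y : ℝ => y) ν) (k : ℕ) (c : ℝ) :
    meanOvershoot ν k c ≤ k * (∫ y, |y| ∂ν) + |c| := by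
  have h0 : 0 ≤ ∫ y, |y| ∂ν := integral_nonneg fun y => abs_nonneg y
  induction k generalizing c with
  | zero =>
    rcases lt_or_ge c 0 with hc | hc
    · rw [meanOvershoot_of_neg ν _ hc, abs_of_neg hc]; simp
    · simp [meanOvershoot, hc]
  | succ k ih =>
    rcases lt_or_ge c 0 with hc | hc
    · rw [meanOvershoot_of_neg ν _ hc, abs_of_neg hc]
      have : 0 ≤ ((k + 1 : ℕ) : ℝ) * ∫ y, |y| ∂ν := by positivity
      linarith
    · rw [meanOvershoot_succ ν _ hc]
      calc ∫ y, meanOvershoot ν k (c - y) ∂ν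
          ≤ ∫ y, ((k * (∫ y, |y| ∂ν) + |c|) + |y|) ∂ν := by
            refine integral_mono_of_nonneg (ae_of_all _ fun y => meanOvershoot_nonneg _ _)
              ((integrable_const _).add h1.abs) (ae_of_all _ fun y => ?_)
            have := ih (c - y)
            have := abs_sub c y
            simp only
            linarith
        _ = _ := by
            rw [integral_add (integrable_const _) h1.abs]
            simp only [integral_const, probReal_univ, one_smul]
            push_cast
            ring

lemma integrable_meanOvershoot (h1 : Integrable (fun y : ℝ => y) ν) (k : ℕ) (c : ℝ) :
    Integrable (fun y => meanOvershoot ν k (c - y)) ν := by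
  refine Integrable.mono' (((integrable_const (k * (∫ y, |y| ∂ν) + |c|)).add h1.abs))
    ((measurable_meanOvershoot k).comp
      (measurable_const.sub measurable_id)).aestronglyMeasurable (ae_of_all _ fun y => ?_)
  rw [Real.norm_of_nonneg (meanOvershoot_nonneg _ _)]
  have := meanOvershoot_le h1 k (c - y)
  have := abs_sub c y
  simp only [Pi.add_apply]
  linarith

lemma integrable_meanOvershoot_sq (h1 : Integrable (fun y : ℝ => y) ν)
    (h2 : Integrable (fun y : ℝ => y ^ 2) ν) (k : ℕ) (c : ℝ) :
    Integrable (fun y => meanOvershoot ν k (c - y) ^ 2) ν := by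
  set D := k * (∫ y, |y| ∂ν) + |c|
  refine Integrable.mono' (((integrable_const (2 * D ^ 2)).add (h2.const_mul 2)))
    (((measurable_meanOvershoot k).comp
      (measurable_const.sub measurable_id)).pow_const 2).aestronglyMeasurable
    (ae_of_all _ fun y => ?_)
  rw [Real.norm_of_nonneg (sq_nonneg _)]
  have h3 := meanOvershoot_le h1 k (c - y)
  have h4 := abs_sub c y
  have h5 : meanOvershoot ν k (c - y) ≤ D + |y| := by simp only [D]; linarith
  have h6 := meanOvershoot_nonneg (ν := ν) k (c - y)
  simp only [Pi.add_apply]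
  nlinarith [sq_nonneg (D - |y|), sq_abs y]

/-- The left side is the mean of position minus `c` at the truncated passage time. Paths that have
not crossed contribute a nonpositive amount to it and zero to the overshoot. -/
lemma mul_meanPassage_sub_le_meanOvershoot (h1 : Integrable (fun y : ℝ => y) ν) (k : ℕ) (c : ℝ) :
    (∫ y, y ∂ν) * meanPassage ν k c - c ≤ meanOvershoot ν k c := by
  induction k generalizing c with
  | zero =>
    rcases lt_or_ge c 0 with hc | hc
    · rw [meanOvershoot_of_neg ν _ hc]; simp [meanPassage]
    · simp [meanOvershoot, meanPassage, hc]
  | succ k ih =>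
    rcases lt_or_ge c 0 with hc | hc
    · rw [meanOvershoot_of_neg ν _ hc, meanPassage_of_neg ν _ hc]; simp
    · rw [meanOvershoot_succ ν _ hc, meanPassage_succ ν _ hc]
      have ht := (integrable_meanPassage (ν := ν) k c).const_mul (∫ y, y ∂ν)
      have htc : Integrable (fun y => (∫ y, y ∂ν) * meanPassage ν k (c - y) - c) ν :=
        ht.sub (integrable_const c)
      have h : ∫ y, ((∫ y, y ∂ν) * meanPassage ν k (c - y) - c + y) ∂ν ≤
          ∫ y, meanOvershoot ν k (c - y) ∂ν :=
        integral_mono (htc.add h1) (integrable_meanOvershoot h1 k c) fun y => by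
          have := ih (c - y)
          simp only
          linarith
      rw [integral_add htc h1, integral_sub ht (integrable_const c), integral_const_mul] at h
      simp only [integral_const, probReal_univ, one_smul] at h
      linarith

end

/-! ### Integrated overshoot and Lorden's inequality -/

lemma integrable_posPart_sq {ν : Measure ℝ} (h2 : Integrable (fun y : ℝ => y ^ 2) ν) :
    Integrable (fun y : ℝ => (max 0 y) ^ 2) ν := by
  refine h2.mono' (by fun_prop : Measurable fun y : ℝ => (max 0 y) ^ 2).aestronglyMeasurable
    (ae_of_all _ fun y => ?_)
  rw [Real.norm_of_nonneg (sq_nonneg _)]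
  rcases le_total 0 y with h | h
  · rw [max_eq_right h]
  · rw [max_eq_left h]; nlinarith [sq_nonneg y]

/-- With the oriented integral, `2 ∫₀ᶜ r + r(c)²` vanishes for `c < 0`, so the recursion for it
stops correctly after the crossing. -/
lemma integral_meanOvershoot_of_nonpos (ν : Measure ℝ) (k : ℕ) {c : ℝ} (hc : c ≤ 0) :
    ∫ b in (0 : ℝ)..c, meanOvershoot ν k b = -c ^ 2 / 2 := by
  have h : ∫ b in c..(0 : ℝ), meanOvershoot ν k b = ∫ b in c..(0 : ℝ), -b :=
    intervalIntegral.integral_congr_Ioo_of_le hc fun b hb => meanOvershoot_of_neg ν k hb.2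
  rw [intervalIntegral.integral_symm, h, intervalIntegral.integral_neg, integral_id]
  ring

section

variable {ν : Measure ℝ} [IsProbabilityMeasure ν]

lemma intervalIntegrable_meanOvershoot (h1 : Integrable (fun y : ℝ => y) ν) (k : ℕ) (a b : ℝ) :
    IntervalIntegrable (meanOvershoot ν k) volume a b := by
  have hg : IntervalIntegrable (fun c : ℝ => k * (∫ y, |y| ∂ν) + |c|) volume a b :=
    (by fun_prop : Continuous fun c : ℝ => k * (∫ y, |y| ∂ν) + |c|).intervalIntegrable a b
  refine hg.mono_fun (measurable_meanOvershoot k).aestronglyMeasurable (ae_of_all _ fun c => ?_)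
  simp only [Real.norm_of_nonneg (meanOvershoot_nonneg _ _)]
  exact (meanOvershoot_le h1 k c).trans (le_abs_self _)

lemma abs_integral_meanOvershoot_le (h1 : Integrable (fun y : ℝ => y) ν) (k : ℕ) (c : ℝ) :
    |∫ b in (0 : ℝ)..c, meanOvershoot ν k b| ≤ (k * (∫ y, |y| ∂ν) + |c|) * |c| := by
  have := intervalIntegral.norm_integral_le_of_norm_le_const (a := 0) (b := c)
    (f := meanOvershoot ν k) (C := k * (∫ y, |y| ∂ν) + |c|) (fun b hb => by
      rw [Real.norm_of_nonneg (meanOvershoot_nonneg _ _)]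
      have h := meanOvershoot_le h1 k b
      have : |b| ≤ |c| := by
        have := Set.abs_sub_left_of_mem_uIcc (Set.uIoc_subset_uIcc hb)
        simpa using this
      linarith)
  simpa using this

lemma continuous_integral_meanOvershoot (h1 : Integrable (fun y : ℝ => y) ν) (k : ℕ) :
    Continuous fun c => ∫ b in (0 : ℝ)..c, meanOvershoot ν k b :=
  intervalIntegral.continuous_primitive (fun a b => intervalIntegrable_meanOvershoot h1 k a b) 0

lemma integrable_integral_meanOvershoot (h1 : Integrable (fun y : ℝ => y) ν)
    (h2 : Integrable (fun y : ℝ => y ^ 2) ν) (k : ℕ) (c : ℝ) :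
    Integrable (fun y => ∫ b in (0 : ℝ)..(c - y), meanOvershoot ν k b) ν := by
  set D := k * (∫ y, |y| ∂ν)
  refine Integrable.mono' ((((integrable_const (D ^ 2 + 4 * c ^ 2)).add (h2.const_mul 4))))
    ((continuous_integral_meanOvershoot h1 k).measurable.comp
      (measurable_const.sub measurable_id)).aestronglyMeasurable
    (ae_of_all _ fun y => ?_)
  have h3 := abs_integral_meanOvershoot_le h1 k (c - y)
  simp only [Pi.add_apply, Real.norm_eq_abs]
  refine h3.trans ?_
  change (D + |c - y|) * |c - y| ≤ _
  have : |c - y| ^ 2 = (c - y) ^ 2 := sq_abs _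
  nlinarith [sq_nonneg (D - |c - y|), sq_nonneg (c + y), sq_nonneg D]

/-- Fubini and the shift `b ↦ b - y` give an integral over `[-y, c - y]`, split here at `0`. The
second term is the cost of a single step. -/
lemma integral_meanOvershoot_succ (h1 : Integrable (fun y : ℝ => y) ν)
    (h2 : Integrable (fun y : ℝ => y ^ 2) ν) (k : ℕ) {c : ℝ} (hc : 0 ≤ c) :
    ∫ b in (0 : ℝ)..c, meanOvershoot ν (k + 1) b =
      (∫ y, (∫ b in (0 : ℝ)..(c - y), meanOvershoot ν k b) ∂ν) -
        ∫ y, (∫ b in (0 : ℝ)..(0 - y), meanOvershoot ν k b) ∂ν := by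
  have h3 : ∫ b in (0 : ℝ)..c, meanOvershoot ν (k + 1) b =
      ∫ b in (0 : ℝ)..c, ∫ y, meanOvershoot ν k (b - y) ∂ν := by
    refine intervalIntegral.integral_congr fun b hb => ?_
    rw [Set.uIcc_of_le hc] at hb
    exact meanOvershoot_succ ν k hb.1
  rw [h3, intervalIntegral_integral_swap, ← integral_sub
    (integrable_integral_meanOvershoot h1 h2 k c) (integrable_integral_meanOvershoot h1 h2 k 0)]
  · refine integral_congr_ae (ae_of_all _ fun y => ?_)
    simp only
    rw [intervalIntegral.integral_comp_sub_right (fun b => meanOvershoot ν k b),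
      intervalIntegral.integral_interval_sub_left (intervalIntegrable_meanOvershoot h1 k _ _)
        (intervalIntegrable_meanOvershoot h1 k _ _)]
  · have hfin : IsFiniteMeasure (volume.restrict (Set.uIoc 0 c)) := ⟨by simp [Set.uIoc]⟩
    have hg : Integrable (fun p : ℝ × ℝ => (k * (∫ y, |y| ∂ν) + |c|) + |p.2|)
        ((volume.restrict (Set.uIoc 0 c)).prod ν) :=
      (integrable_const _).add (h1.abs.comp_snd _)
    refine hg.mono' ((measurable_meanOvershoot k).comp
      (measurable_fst.sub measurable_snd)).aestronglyMeasurable ?_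
    have hae : ∀ᵐ p ∂((volume.restrict (Set.uIoc 0 c)).prod ν), p.1 ∈ Set.uIoc 0 c :=
      Measure.quasiMeasurePreserving_fst.ae (ae_restrict_mem measurableSet_uIoc)
    filter_upwards [hae] with p hp
    simp only [Function.uncurry]
    rw [Real.norm_of_nonneg (meanOvershoot_nonneg _ _)]
    rw [Set.uIoc_of_le hc] at hp
    have h4 := meanOvershoot_le h1 k (p.1 - p.2)
    have h5 := abs_sub p.1 p.2
    have h6 : |p.1| ≤ |c| := by rw [abs_of_pos hp.1, abs_of_nonneg hc]; exact hp.2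
    linarith

lemma sq_integral_le_integral_sq {f : ℝ → ℝ} (hf : Integrable f ν)
    (hf2 : Integrable (fun y => f y ^ 2) ν) : (∫ y, f y ∂ν) ^ 2 ≤ ∫ y, f y ^ 2 ∂ν := by
  set a := ∫ y, f y ∂ν
  have h : ∫ y, (2 * a * f y - a ^ 2) ∂ν ≤ ∫ y, f y ^ 2 ∂ν :=
    integral_mono ((hf.const_mul _).sub (integrable_const _)) hf2 fun y => by
      simp only
      nlinarith [sq_nonneg (f y - a)]
  rw [integral_sub (hf.const_mul _) (integrable_const _), integral_const_mul] at h
  simp only [integral_const, probReal_univ, one_smul] at h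
  nlinarith

/-- The integrated form of the estimate of the overshoot by the squares of the upward steps. -/
lemma two_mul_integral_meanOvershoot_add_sq_le (h1 : Integrable (fun y : ℝ => y) ν)
    (h2 : Integrable (fun y : ℝ => y ^ 2) ν) (k : ℕ) (c : ℝ) :
    2 * (∫ b in (0 : ℝ)..c, meanOvershoot ν k b) + meanOvershoot ν k c ^ 2 ≤
      (∫ y, (max 0 y) ^ 2 ∂ν) * meanPassage ν k c := by
  set σ := ∫ y, (max 0 y) ^ 2 ∂ν
  induction k generalizing c with
  | zero =>
    rcases lt_or_ge c 0 with hc | hc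
    · rw [integral_meanOvershoot_of_nonpos ν _ hc.le, meanOvershoot_of_neg ν _ hc]
      simp only [meanPassage]
      linarith
    · have : ∫ b in (0 : ℝ)..c, meanOvershoot ν 0 b = 0 := by
        rw [intervalIntegral.integral_congr (g := fun _ => (0 : ℝ)) fun b hb => ?_]
        · simp
        · rw [Set.uIcc_of_le hc] at hb
          simp [meanOvershoot, hb.1]
      rw [this]
      simp [meanOvershoot, meanPassage, hc]
  | succ k ih =>
    rcases lt_or_ge c 0 with hc | hc
    · rw [integral_meanOvershoot_of_nonpos ν _ hc.le, meanOvershoot_of_neg ν _ hc,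
        meanPassage_of_neg ν _ hc]
      linarith
    · rw [integral_meanOvershoot_succ h1 h2 k hc, meanOvershoot_succ ν _ hc,
        meanPassage_succ ν _ hc]
      have hI := integrable_integral_meanOvershoot h1 h2 k
      have hr := integrable_meanOvershoot_sq h1 h2 k c
      -- Jensen: the square of the averaged overshoot is at most the average of the squares to which
      -- the induction hypothesis applies.
      have hsq := sq_integral_le_integral_sq (integrable_meanOvershoot h1 k c) hr
      have hstep : ∫ y, (2 * (∫ b in (0 : ℝ)..(c - y), meanOvershoot ν k b) +
          meanOvershoot ν k (c - y) ^ 2) ∂ν ≤ ∫ y, σ * meanPassage ν k (c - y) ∂ν :=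
        integral_mono (((hI c).const_mul 2).add hr) ((integrable_meanPassage k c).const_mul σ)
          fun y => ih (c - y)
      rw [integral_add ((hI c).const_mul 2) hr, integral_const_mul, integral_const_mul] at hstep
      -- The cost of one step `y`: exactly `y²` if `y ≥ 0`, and nonpositive if `y ≤ 0`.
      have hlast : ∫ y, -(2 * ∫ b in (0 : ℝ)..(0 - y), meanOvershoot ν k b) ∂ν ≤ σ := by
        refine integral_mono ((hI 0).const_mul 2).neg (integrable_posPart_sq h2) fun y => ?_
        simp only
        rcases le_total 0 y with hy | hy
        · rw [integral_meanOvershoot_of_nonpos ν _ (by linarith), max_eq_right hy]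
          apply le_of_eq
          ring
        · have : 0 ≤ ∫ b in (0 : ℝ)..(0 - y), meanOvershoot ν k b :=
            intervalIntegral.integral_nonneg (by linarith) fun b _ => meanOvershoot_nonneg _ _
          nlinarith [sq_nonneg (max 0 y)]
      rw [integral_neg, integral_const_mul] at hlast
      linarith

/-- **Lorden's inequality**, for the passage time truncated at `k`. -/
theorem mul_meanPassage_le (h1 : Integrable (fun y : ℝ => y) ν)
    (h2 : Integrable (fun y : ℝ => y ^ 2) ν) (hpos : 0 < ∫ y, y ∂ν) (k : ℕ) {c : ℝ} (hc : 0 ≤ c) :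
    (∫ y, y ∂ν) * meanPassage ν k c ≤ c + (∫ y, (max 0 y) ^ 2 ∂ν) / ∫ y, y ∂ν := by
  set M := ∫ y, y ∂ν
  set σ := ∫ y, (max 0 y) ^ 2 ∂ν
  have hσ : 0 ≤ σ := integral_nonneg fun y => sq_nonneg _
  set t := meanPassage ν k c
  set r := meanOvershoot ν k c
  -- Negating the claim makes `M * t - c` positive, which is what allows `M * t - c ≤ r` to be
  -- squared.
  by_contra! hlt
  have hr : M * t - c ≤ r := mul_meanPassage_sub_le_meanOvershoot h1 k c
  have hψ := two_mul_integral_meanOvershoot_add_sq_le h1 h2 k c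
  have ht := mul_meanPassage_le_integral (ν := ν) k hc
  have hti : IntervalIntegrable (meanPassage ν k) volume 0 c :=
    (meanPassage_mono k).intervalIntegrable
  have hle : ∫ b in (0 : ℝ)..c, (M * meanPassage ν k b - b) ≤
      ∫ b in (0 : ℝ)..c, meanOvershoot ν k b :=
    intervalIntegral.integral_mono_on hc
      ((hti.const_mul M).sub intervalIntegral.intervalIntegrable_id)
      (intervalIntegrable_meanOvershoot h1 k 0 c)
      fun b _ => mul_meanPassage_sub_le_meanOvershoot h1 k b
  rw [intervalIntegral.integral_sub (hti.const_mul M) intervalIntegral.intervalIntegrable_id,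
    intervalIntegral.integral_const_mul, integral_id] at hle
  have hα : σ / M * M = σ := div_mul_cancel₀ _ hpos.ne'
  set α := σ / M
  have hα0 : 0 ≤ α := div_nonneg hσ hpos.le
  have hx : 0 < M * t - c := by linarith
  have hsq : (M * t - c) ^ 2 ≤ r ^ 2 := pow_le_pow_left₀ hx.le hr 2
  have h3 : c * (M * t) ≤ c ^ 2 + α * (M * t) - (M * t - c) ^ 2 := by
    have e1 : M * (c * t) ≤ M * (2 * ∫ b in (0 : ℝ)..c, meanPassage ν k b) :=
      mul_le_mul_of_nonneg_left ht hpos.le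
    have e2 : α * (M * t) = σ * t := by rw [← mul_assoc, hα]
    rw [e2]
    linarith
  -- `h3` rearranges to the statement that this product is at most `0`.
  have h4 : 0 < (M * t - c - α) * (M * t) := mul_pos (by linarith) (by linarith)
  nlinarith

end

/-! ### Passage times on path space -/

/-- The minimum of `k` and the first passage time over the level `c` of the walk with increments
`f x, f (S x), f (S (S x)), …`, where `S` shifts a sequence by `K` places. -/
noncomputable def truncPassage {E : Type*} (f : (ℕ → E) → ℝ) (K : ℕ) : ℕ → ℝ → (ℕ → E) → ℕ
  | 0, _, _ => 0
  | k + 1, c, x => if 0 ≤ c then 1 + truncPassage f K k (c - f x) (fun i => x (K + i)) else 0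

section

variable {E : Type*}

lemma truncPassage_of_neg (f : (ℕ → E) → ℝ) (K k : ℕ) {c : ℝ} (hc : c < 0) (x : ℕ → E) :
    truncPassage f K k c x = 0 := by
  cases k <;> simp [truncPassage, hc]

lemma truncPassage_succ (f : (ℕ → E) → ℝ) (K k : ℕ) {c : ℝ} (hc : 0 ≤ c) (x : ℕ → E) :
    truncPassage f K (k + 1) c x = 1 + truncPassage f K k (c - f x) (fun i => x (K + i)) := by
  simp [truncPassage, hc]

lemma truncPassage_le_succ (f : (ℕ → E) → ℝ) (K k : ℕ) (c : ℝ) (x : ℕ → E) :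
    truncPassage f K k c x ≤ truncPassage f K (k + 1) c x := by
  induction k generalizing c x with
  | zero => simp [truncPassage]
  | succ k ih =>
    rcases lt_or_ge c 0 with hc | hc
    · rw [truncPassage_of_neg _ _ _ hc, truncPassage_of_neg _ _ _ hc]
    · rw [truncPassage_succ _ _ _ hc, truncPassage_succ _ _ _ hc]
      exact Nat.add_le_add_left (ih _ _) 1

/-- The recursion returns less than `k` only if the remaining level has become negative, that is, if
the blocks used so far already exceed `c`. -/
lemma truncPassage_eq_or_lt_sum (g : E → ℝ) (K k : ℕ) (c : ℝ) (x : ℕ → E) :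
    truncPassage (fun x => ∑ i ∈ Finset.range K, g (x i)) K k c x = k ∨
      c < ∑ i ∈ Finset.range
        (K * truncPassage (fun x => ∑ i ∈ Finset.range K, g (x i)) K k c x), g (x i) := by
  induction k generalizing c x with
  | zero => exact Or.inl rfl
  | succ k ih =>
    rcases lt_or_ge c 0 with hc | hc
    · rw [truncPassage_of_neg _ _ _ hc]
      exact Or.inr (by simpa using hc)
    · rw [truncPassage_succ _ _ _ hc]
      rcases ih (c - ∑ i ∈ Finset.range K, g (x i)) (fun i => x (K + i)) with h | h
      · exact Or.inl (by omega)
      · refine Or.inr ?_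
        rw [mul_add, mul_one, Finset.sum_range_add]
        linarith

variable [MeasurableSpace E]

lemma measurable_truncPassage {f : (ℕ → E) → ℝ} (hf : Measurable f) (K k : ℕ) :
    Measurable (fun p : ℝ × (ℕ → E) => truncPassage f K k p.1 p.2) := by
  induction k with
  | zero => exact measurable_const
  | succ k ih =>
    refine Measurable.ite (measurableSet_le measurable_const measurable_fst) ?_ measurable_const
    have : Measurable fun p : ℝ × (ℕ → E) => (p.1 - f p.2, fun i => p.2 (K + i)) :=
      (measurable_fst.sub (hf.comp measurable_snd)).prodMk
        (measurable_pi_lambda _ fun i => (measurable_pi_apply _).comp measurable_snd)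
    exact (ih.comp this).const_add 1

/-- The one-step decomposition of a law on sequences of which the increment `f` is independent of
the sequence shifted by `K` places, the latter having the same law. -/
lemma lintegral_truncPassage {Q : Measure (ℕ → E)} [IsProbabilityMeasure Q] {f : (ℕ → E) → ℝ}
    (hf : Measurable f) (K : ℕ)
    (hQ : Q.map (fun x => (f x, fun i => x (K + i))) = (Q.map f).prod Q) (k : ℕ) (c : ℝ) :
    ∫⁻ x, (truncPassage f K k c x : ℝ≥0∞) ∂Q = ENNReal.ofReal (meanPassage (Q.map f) k c) := by
  have hprob : IsProbabilityMeasure (Q.map f) := Measure.isProbabilityMeasure_map hf.aemeasurable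
  induction k generalizing c with
  | zero => simp [truncPassage, meanPassage]
  | succ k ih =>
    rcases lt_or_ge c 0 with hc | hc
    · simp [truncPassage_of_neg _ _ _ hc, meanPassage_of_neg _ _ hc]
    · have hm : Measurable fun p : ℝ × (ℕ → E) => (truncPassage f K k (c - p.1) p.2 : ℝ≥0∞) :=
        measurable_from_top.comp ((measurable_truncPassage hf K k).comp
          ((measurable_const.sub measurable_fst).prodMk measurable_snd))
      have hs : Measurable fun x : ℕ → E => (f x, fun i => x (K + i)) :=
        hf.prodMk (measurable_pi_lambda _ fun i => measurable_pi_apply _)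
      have hstep : ∫⁻ x, (truncPassage f K k (c - f x) (fun i => x (K + i)) : ℝ≥0∞) ∂Q =
          ENNReal.ofReal (∫ y, meanPassage (Q.map f) k (c - y) ∂(Q.map f)) := by
        -- Under the product law the first increment is frozen at `y`, and the induction hypothesis
        -- applies at the level `c - y`.
        rw [← lintegral_map hm hs, hQ, lintegral_prod _ hm.aemeasurable]
        simp_rw [ih]
        rw [ofReal_integral_eq_lintegral_ofReal (integrable_meanPassage k c)
          (ae_of_all _ fun y => meanPassage_nonneg _ _)]
      simp_rw [truncPassage_succ _ _ _ hc]
      rw [meanPassage_succ _ _ hc, ENNReal.ofReal_add zero_le_one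
        (integral_nonneg fun y => meanPassage_nonneg _ _), ← hstep]
      push_cast
      rw [lintegral_add_left measurable_const]
      simp

/-- The block depends on the coordinates below `K` and the shifted sequence on the others, whence
independence; reindexing an i.i.d. sequence along an injection preserves its law. -/
lemma map_block_prod_shift (ν : Measure E) [IsProbabilityMeasure ν] {g : E → ℝ} (hg : Measurable g)
    (K : ℕ) :
    (Measure.infinitePi fun _ : ℕ => ν).map
        (fun x => (∑ i ∈ Finset.range K, g (x i), fun i => x (K + i))) =
      ((Measure.infinitePi fun _ : ℕ => ν).map (fun x => ∑ i ∈ Finset.range K, g (x i))).prod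
        (Measure.infinitePi fun _ : ℕ => ν) := by
  set Q := Measure.infinitePi fun _ : ℕ => ν
  have hf : Measurable fun x : ℕ → E => ∑ i ∈ Finset.range K, g (x i) :=
    Finset.measurable_sum _ fun i _ => hg.comp (measurable_pi_apply i)
  have hs : Measurable fun (x : ℕ → E) (i : ℕ) => x (K + i) :=
    measurable_pi_lambda _ fun i => measurable_pi_apply _
  have hmap : Q.map (fun (x : ℕ → E) (i : ℕ) => x (K + i)) = Q :=
    Measure.map_infinitePi_infinitePi_of_inj (add_right_injective K)
  have hi : iIndepFun (fun (i : ℕ) (x : ℕ → E) => x i) Q :=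
    iIndepFun_infinitePi (fun _ => measurable_id)
  have hind : IndepFun (fun x : ℕ → E => ∑ i ∈ Finset.range K, g (x i))
      (fun x i => x (K + i)) Q := by
    have h := indep_iSup_of_disjoint (fun i => (measurable_pi_apply i).comap_le) hi
      (S := {i | i < K}) (T := {i | K ≤ i}) (Set.disjoint_left.2 fun i h1 h2 => by
        simp only [Set.mem_ofPred_eq] at h1 h2; omega)
    refine indep_of_indep_of_le_left (indep_of_indep_of_le_right h ?_) ?_
    · rw [← measurable_iff_comap_le]
      refine @measurable_pi_lambda _ _ _ (_) _ _ fun i => ?_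
      rw [measurable_iff_comap_le]
      exact le_iSup₂_of_le (K + i) (by simp) le_rfl
    · rw [← measurable_iff_comap_le]
      refine Finset.measurable_sum _ fun i hi' => hg.comp ?_
      rw [measurable_iff_comap_le]
      exact le_iSup₂_of_le i (Finset.mem_range.1 hi') le_rfl
  rw [hind.map_prod_eq_prod_map_map hf.aemeasurable hs.aemeasurable, hmap]

end

/-! ### Exit time from `R` against passage over `C` -/

section

variable {d : ℕ} {Ω : Type*}

lemma inner_sampleSum_add (A : EuclideanSpace ℝ (Fin d)) (B : ℝ)
    (ξ : ℕ → Ω → EuclideanSpace ℝ (Fin d)) (n : ℕ) (ω : Ω) :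
    inner ℝ A (sampleSum ξ n ω) + B * n = ∑ i ∈ Finset.range n, (inner ℝ A (ξ i ω) + B) := by
  rw [sampleSum, inner_sum, Finset.sum_add_distrib]
  simp [mul_comm]

lemma exitTime_le_of_lt {K : ℕ} {R : Set (ℝ × EuclideanSpace ℝ (Fin d))}
    {A : EuclideanSpace ℝ (Fin d)} {B C : ℝ} (hside : ∀ q ∈ R, inner ℝ A q.2 + B * q.1 ≤ C)
    {ξ : ℕ → Ω → EuclideanSpace ℝ (Fin d)} {ω : Ω} {n : ℕ} (hn : 0 < n) (hKn : K ∣ n)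
    (hlt : C < ∑ i ∈ Finset.range n, (inner ℝ A (ξ i ω) + B)) :
    exitTime K R ξ ω ≤ n := by
  refine sInf_le ⟨n, rfl, hn, hKn, fun hmem => ?_⟩
  have := hside _ hmem
  rw [inner_sampleSum_add] at this
  exact this.not_gt hlt

lemma exitTime_le_iSup {K : ℕ} (hK : 0 < K) {R : Set (ℝ × EuclideanSpace ℝ (Fin d))}
    {A : EuclideanSpace ℝ (Fin d)} {B C : ℝ} (hC : 0 ≤ C)
    (hside : ∀ q ∈ R, inner ℝ A q.2 + B * q.1 ≤ C)
    (ξ : ℕ → Ω → EuclideanSpace ℝ (Fin d)) (ω : Ω) :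
    (exitTime K R ξ ω : ℝ≥0∞) ≤ K * ⨆ k : ℕ, (truncPassage
      (fun x => ∑ i ∈ Finset.range K, (inner ℝ A (x i) + B)) K k C (fun i => ξ i ω) : ℝ≥0∞) := by
  set T := fun k => truncPassage
    (fun x => ∑ i ∈ Finset.range K, (inner ℝ A (x i) + B)) K k C (fun i => ξ i ω)
  -- If every truncation is active the right side is `⊤`; otherwise some `k` shows an actual
  -- crossing after `K * T k` samples.
  by_cases h : ∀ k, T k = k
  · have : ⨆ k : ℕ, (T k : ℝ≥0∞) = ⊤ := by
      simp only [h]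
      exact ENNReal.iSup_natCast
    rw [this, ENNReal.mul_top (by exact_mod_cast hK.ne')]
    exact le_top
  · push Not at h
    obtain ⟨k, hk⟩ := h
    have hlt := (truncPassage_eq_or_lt_sum (fun y => inner ℝ A y + B) K k C
      (fun i => ξ i ω)).resolve_left hk
    change C < ∑ i ∈ Finset.range (K * T k), (inner ℝ A (ξ i ω) + B) at hlt
    -- The exit time ignores `n = 0`, and the empty sum cannot exceed `C ≥ 0`.
    have hT : 0 < T k := by
      by_contra! h0
      rw [Nat.le_zero.1 h0] at hlt
      simp only [mul_zero, Finset.range_zero, Finset.sum_empty] at hlt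
      linarith
    have hle := ENat.toENNReal_le.2
      (exitTime_le_of_lt hside (Nat.mul_pos hK hT) (dvd_mul_right K (T k)) hlt)
    rw [ENat.toENNReal_coe, Nat.cast_mul] at hle
    exact hle.trans (mul_le_mul_right (le_iSup (fun k => (T k : ℝ≥0∞)) k) _)

variable [MeasurableSpace Ω] {P : Measure Ω} [IsProbabilityMeasure P]

lemma map_path_eq_infinitePi {E : Type*} [MeasurableSpace E] {X : Ω → E} {ξ : ℕ → Ω → E}
    (hindep : iIndepFun ξ P) (hident : ∀ i, IdentDistrib (ξ i) X P P) :
    P.map (fun ω i => ξ i ω) = Measure.infinitePi fun _ : ℕ => P.map X := by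
  rw [(iIndepFun_iff_map_fun_eq_infinitePi_map₀' fun i => (hident i).aemeasurable_fst).1 hindep]
  congr with i
  rw [(hident i).map_eq]

/-- Lorden's bound does not depend on `k`, so it passes to the supremum of the truncated passage
times by monotone convergence on path space. -/
lemma lintegral_exitTime_le {X : Ω → EuclideanSpace ℝ (Fin d)}
    {ξ : ℕ → Ω → EuclideanSpace ℝ (Fin d)} (hindep : iIndepFun ξ P)
    (hident : ∀ i, IdentDistrib (ξ i) X P P) {K : ℕ} (hK : 0 < K)
    {R : Set (ℝ × EuclideanSpace ℝ (Fin d))} {A : EuclideanSpace ℝ (Fin d)} {B C : ℝ} (hC : 0 ≤ C)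
    (hside : ∀ q ∈ R, inner ℝ A q.2 + B * q.1 ≤ C) {Z : Ω → ℝ}
    (hZ : ∀ ω, Z ω = ∑ i ∈ Finset.range K, (inner ℝ A (ξ i ω) + B))
    (h2 : MemLp Z 2 P) (hpos : 0 < ∫ ω, Z ω ∂P) :
    ∫⁻ ω, (exitTime K R ξ ω : ℝ≥0∞) ∂P ≤ ENNReal.ofReal
      (K * ((C + (∫ ω, (max 0 (Z ω)) ^ 2 ∂P) / ∫ ω, Z ω ∂P) / ∫ ω, Z ω ∂P)) := by
  set f : (ℕ → EuclideanSpace ℝ (Fin d)) → ℝ :=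
    fun x => ∑ i ∈ Finset.range K, (inner ℝ A (x i) + B)
  have hg : Measurable fun y : EuclideanSpace ℝ (Fin d) => inner ℝ A y + B := by fun_prop
  have hf : Measurable f := Finset.measurable_sum _ fun i _ => hg.comp (measurable_pi_apply i)
  have hξ : AEMeasurable (fun ω i => ξ i ω) P :=
    aemeasurable_pi_lambda _ fun i => (hident i).aemeasurable_fst
  have hXprob : IsProbabilityMeasure (P.map X) :=
    Measure.isProbabilityMeasure_map (hident 0).aemeasurable_snd
  set Q := P.map (fun ω i => ξ i ω)
  have hQprob : IsProbabilityMeasure Q := Measure.isProbabilityMeasure_map hξ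
  have hQ : Q.map (fun x => (f x, fun i => x (K + i))) = (Q.map f).prod Q := by
    have hQX : Q = _ := map_path_eq_infinitePi hindep hident
    rw [hQX]
    exact map_block_prod_shift (P.map X) hg K
  have hZf : Z = f ∘ fun ω i => ξ i ω := funext hZ
  have hZm : AEMeasurable Z P := h2.1.aemeasurable
  have hQZ : Q.map f = P.map Z := by
    rw [hZf, AEMeasurable.map_map_of_aemeasurable hf.aemeasurable hξ]
  set ν := P.map Z
  have hνprob : IsProbabilityMeasure ν := Measure.isProbabilityMeasure_map hZm
  have hν1 : Integrable (fun y : ℝ => y) ν :=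
    (integrable_map_measure (by fun_prop) hZm).2 (h2.integrable one_le_two)
  have hν2 : Integrable (fun y : ℝ => y ^ 2) ν :=
    (integrable_map_measure (by fun_prop) hZm).2 h2.integrable_sq
  have hM : ∫ y, y ∂ν = ∫ ω, Z ω ∂P := integral_map hZm (by fun_prop)
  have hσ : ∫ y, (max 0 y) ^ 2 ∂ν = ∫ ω, (max 0 (Z ω)) ^ 2 ∂P := integral_map hZm (by fun_prop)
  rw [← hM, ← hσ]
  rw [← hM] at hpos
  have hTm : ∀ k, Measurable fun x => (truncPassage f K k C x : ℝ≥0∞) := fun k =>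
    measurable_from_top.comp ((measurable_truncPassage hf K k).comp
      (measurable_const.prodMk measurable_id))
  have hTmono : Monotone fun (k : ℕ) x => (truncPassage f K k C x : ℝ≥0∞) :=
    monotone_nat_of_le_succ fun k x => by
      simpa using truncPassage_le_succ f K k C x
  calc ∫⁻ ω, (exitTime K R ξ ω : ℝ≥0∞) ∂P
      ≤ ∫⁻ ω, K * ⨆ k : ℕ, (truncPassage f K k C (fun i => ξ i ω) : ℝ≥0∞) ∂P :=
        lintegral_mono fun ω => exitTime_le_iSup hK hC hside ξ ω
    _ = ∫⁻ x, K * ⨆ k : ℕ, (truncPassage f K k C x : ℝ≥0∞) ∂Q :=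
        (lintegral_map' ((Measurable.iSup hTm).const_mul _).aemeasurable hξ).symm
    _ = K * ⨆ k : ℕ, ENNReal.ofReal (meanPassage ν k C) := by
        rw [lintegral_const_mul _ (Measurable.iSup hTm), lintegral_iSup hTm hTmono]
        simp_rw [lintegral_truncPassage hf K hQ, hQZ]
    _ ≤ K * ENNReal.ofReal ((C + (∫ y, (max 0 y) ^ 2 ∂ν) / ∫ y, y ∂ν) / ∫ y, y ∂ν) := by
        gcongr
        refine iSup_le fun k => ENNReal.ofReal_le_ofReal ?_
        rw [le_div_iff₀ hpos, mul_comm]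
        exact mul_meanPassage_le hν1 hν2 hpos k hC
    _ = _ := by
        rw [ENNReal.ofReal_mul (by positivity), ENNReal.ofReal_natCast]

end

/-! ### Moments and ranges of the block sum -/

section

variable {Ω : Type*} [MeasurableSpace Ω] {P : Measure Ω}

lemma posPart_sq_le_sq (z : ℝ) : (max 0 z) ^ 2 ≤ z ^ 2 := by
  rcases le_total 0 z with h | h
  · rw [max_eq_right h]
  · rw [max_eq_left h]; nlinarith [sq_nonneg z]

lemma MeasureTheory.MemLp.integrable_posPart_sq {Z : Ω → ℝ} (hZ : MemLp Z 2 P) :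
    Integrable (fun ω => (max 0 (Z ω)) ^ 2) P := by
  refine hZ.integrable_sq.mono' ?_ (ae_of_all _ fun ω => ?_)
  · exact ((aemeasurable_const.sup hZ.1.aemeasurable).pow_const 2).aestronglyMeasurable
  · rw [Real.norm_of_nonneg (sq_nonneg _)]
    exact posPart_sq_le_sq _

lemma integral_posPart_sq_le [IsProbabilityMeasure P] {Z : Ω → ℝ} (hZ : MemLp Z 2 P) :
    ∫ ω, (max 0 (Z ω)) ^ 2 ∂P ≤ Var[Z; P] + (∫ ω, Z ω ∂P) ^ 2 := by
  have h1 : ∫ ω, (max 0 (Z ω)) ^ 2 ∂P ≤ ∫ ω, (Z ^ 2) ω ∂P :=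
    integral_mono hZ.integrable_posPart_sq hZ.integrable_sq fun ω => posPart_sq_le_sq (Z ω)
  rw [variance_eq_sub hZ]
  linarith

/-- Integrates `z² ≤ (p + q) z - p q`, which is `(z - p) (q - z) ≥ 0`. -/
lemma integral_posPart_sq_le_of_mem_Icc [IsProbabilityMeasure P] {Z : Ω → ℝ} (hZ : MemLp Z 2 P) {p q : ℝ}
    (h : ∀ᵐ ω ∂P, Z ω ∈ Set.Icc p q) :
    ∫ ω, (max 0 (Z ω)) ^ 2 ∂P ≤ (p + q) * (∫ ω, Z ω ∂P) - p * q := by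
  have hi := hZ.integrable one_le_two
  have h1 : ∫ ω, (max 0 (Z ω)) ^ 2 ∂P ≤ ∫ ω, ((p + q) * Z ω - p * q) ∂P := by
    refine integral_mono_ae hZ.integrable_posPart_sq
      ((hi.const_mul _).sub (integrable_const _)) ?_
    filter_upwards [h] with ω hω
    have := posPart_sq_le_sq (Z ω)
    nlinarith [mul_nonneg (sub_nonneg.2 hω.1) (sub_nonneg.2 hω.2)]
  rw [integral_sub (hi.const_mul _) (integrable_const _), integral_const_mul] at h1
  simpa using h1

/-- By convexity `(z⁺)²` lies below its chord on `[p, q]`, which joins `(p, 0)` to `(q, q²)`. -/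
lemma integral_posPart_sq_le_of_mem_Icc_of_neg [IsProbabilityMeasure P] {Z : Ω → ℝ} (hZ : MemLp Z 2 P) {p q : ℝ}
    (hp : p < 0) (hq : 0 < q) (h : ∀ᵐ ω ∂P, Z ω ∈ Set.Icc p q) :
    ∫ ω, (max 0 (Z ω)) ^ 2 ∂P ≤ q ^ 2 / (q - p) * ((∫ ω, Z ω ∂P) - p) := by
  have hi := hZ.integrable one_le_two
  have h1 : ∫ ω, (max 0 (Z ω)) ^ 2 ∂P ≤ ∫ ω, q ^ 2 / (q - p) * (Z ω - p) ∂P := by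
    refine integral_mono_ae hZ.integrable_posPart_sq
      ((hi.sub (integrable_const _)).const_mul _) ?_
    filter_upwards [h] with ω hω
    have hqp : 0 < q - p := by linarith
    rw [div_mul_eq_mul_div, le_div_iff₀ hqp]
    rcases le_total 0 (Z ω) with h0 | h0
    · rw [max_eq_right h0]
      have e1 := mul_nonneg (mul_nonneg hq.le h0) (sub_nonneg.2 hω.2)
      have e2 := mul_nonneg (mul_nonneg h0 (sub_nonneg.2 hω.2)) (neg_pos.2 hp).le
      have e3 := mul_nonneg (mul_nonneg hq.le (sub_nonneg.2 hω.2)) (neg_pos.2 hp).le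
      nlinarith
    · rw [max_eq_left h0]
      have := mul_nonneg (sq_nonneg q) (sub_nonneg.2 hω.1)
      linarith
  rw [integral_const_mul, integral_sub hi (integrable_const _)] at h1
  simpa using h1

lemma memLp_iidSum {W : Ω → ℝ} {Y : ℕ → Ω → ℝ} (hident : ∀ i, IdentDistrib (Y i) W P P)
    (hW : MemLp W 2 P) (K : ℕ) : MemLp (∑ i ∈ Finset.range K, Y i) 2 P :=
  memLp_finsetSum' _ fun i _ => (hident i).memLp_iff.2 hW

lemma integral_iidSum {W : Ω → ℝ} {Y : ℕ → Ω → ℝ} (hident : ∀ i, IdentDistrib (Y i) W P P)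
    (hW : Integrable W P) (K : ℕ) :
    ∫ ω, (∑ i ∈ Finset.range K, Y i) ω ∂P = K * ∫ ω, W ω ∂P := by
  simp only [Finset.sum_apply]
  rw [integral_finsetSum _ fun i _ => (hident i).integrable_iff.2 hW,
    Finset.sum_congr rfl fun i _ => (hident i).integral_eq]
  simp

lemma variance_iidSum {W : Ω → ℝ} {Y : ℕ → Ω → ℝ} (hident : ∀ i, IdentDistrib (Y i) W P P)
    (hindep : iIndepFun Y P) (hW : MemLp W 2 P) (K : ℕ) :
    Var[∑ i ∈ Finset.range K, Y i; P] = K * Var[W; P] := by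
  rw [IndepFun.variance_sum (fun i _ => (hident i).memLp_iff.2 hW)
    (fun i _ j _ hij => hindep.indepFun hij),
    Finset.sum_congr rfl fun i _ => (hident i).variance_eq]
  simp

lemma iidSum_mem_Icc {W : Ω → ℝ} {Y : ℕ → Ω → ℝ} (hident : ∀ i, IdentDistrib (Y i) W P P)
    {u v : ℝ} (hW : ∀ᵐ ω ∂P, W ω ∈ Set.Icc u v) (K : ℕ) :
    ∀ᵐ ω ∂P, (∑ i ∈ Finset.range K, Y i) ω ∈ Set.Icc (K * u) (K * v) := by
  have h : ∀ᵐ ω ∂P, ∀ i, Y i ω ∈ Set.Icc u v :=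
    ae_all_iff.2 fun i => (hident i).symm.ae_mem_snd measurableSet_Icc hW
  filter_upwards [h] with ω hω
  rw [Finset.sum_apply]
  constructor
  · simpa using Finset.card_nsmul_le_sum (Finset.range K) (fun i => Y i ω) u fun i _ => (hω i).1
  · simpa using Finset.sum_le_card_nsmul (Finset.range K) (fun i => Y i ω) v fun i _ => (hω i).2

/-- Each `A j * x j` lies within `|A j| (b j - a j) / 2` of its value at the midpoint of `[a j, b
j]`. -/
lemma inner_add_mem_Icc_of_mem_box {d : ℕ} (A x a b : EuclideanSpace ℝ (Fin d)) (B : ℝ)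
    (hx : ∀ j, a j ≤ x j ∧ x j ≤ b j) :
    inner ℝ A x + B ∈ Set.Icc
      (1 / 2 * (∑ j, A j * (a j + b j) + ∑ j, |A j| * (a j - b j)) + B)
      (1 / 2 * (∑ j, A j * (a j + b j) + ∑ j, |A j| * (b j - a j)) + B) := by
  have hin : inner ℝ A x = ∑ j, A j * x j := by
    simp [PiLp.inner_apply, mul_comm]
  rw [hin, ← Finset.sum_add_distrib, ← Finset.sum_add_distrib, Finset.mul_sum, Finset.mul_sum]
  constructor <;>
  · refine add_le_add_left (Finset.sum_le_sum fun j _ => ?_) B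
    obtain ⟨h1, h2⟩ := hx j
    rcases abs_cases (A j) with ⟨h, hA⟩ | ⟨h, hA⟩ <;> rw [h] <;> nlinarith

lemma integral_inner_sub_sq_le [IsProbabilityMeasure P] {d : ℕ} {X : Ω → EuclideanSpace ℝ (Fin d)} (hX : MemLp X 2 P)
    (A μ : EuclideanSpace ℝ (Fin d)) :
    ∫ ω, (inner ℝ A (X ω - μ)) ^ 2 ∂P ≤ ‖A‖ ^ 2 * ∫ ω, ‖X ω - μ‖ ^ 2 ∂P := by
  have hXμ : MemLp (fun ω => X ω - μ) 2 P := hX.sub (memLp_const μ)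
  rw [← integral_const_mul]
  refine integral_mono (hXμ.const_inner A).integrable_sq
    ((hXμ.integrable_norm_pow (by norm_num)).const_mul _) fun ω => ?_
  simp only
  rw [← mul_pow, ← sq_abs]
  exact pow_le_pow_left₀ (abs_nonneg _) (abs_real_inner_le_norm _ _) 2

lemma variance_inner_of_iIndepFun {d : ℕ} {X : Ω → EuclideanSpace ℝ (Fin d)} (hX : MemLp X 2 P)
    (hind : iIndepFun (fun (j : Fin d) (ω : Ω) => X ω j) P) (A : EuclideanSpace ℝ (Fin d)) :
    Var[fun ω => inner ℝ A (X ω); P] = ∑ j, (A j) ^ 2 * Var[fun ω => X ω j; P] := by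
  have hin : (fun ω => inner ℝ A (X ω)) = ∑ j, fun ω => A j * X ω j := by
    ext ω
    simp [PiLp.inner_apply, mul_comm]
  rw [hin, IndepFun.variance_sum]
  · simp_rw [variance_const_mul]
  · exact fun j _ => (memLp_piLp_iff.1 hX j).const_mul (A j)
  · exact fun i _ j _ hij => (hind.indepFun hij).comp (measurable_const_mul (A i))
      (measurable_const_mul (A j))

end

/-! ### The three bounds -/

theorem theorem16 {d : ℕ} {Ω : Type*} [MeasurableSpace Ω] (P : Measure Ω) [IsProbabilityMeasure P]
    (X : Ω → EuclideanSpace ℝ (Fin d)) (ξ : ℕ → Ω → EuclideanSpace ℝ (Fin d))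
    (hindep : iIndepFun ξ P) (hident : ∀ i, IdentDistrib (ξ i) X P P)
    (hsq : ∀ j, Integrable (fun ω => |X ω j| ^ 2) P)
    (μ : EuclideanSpace ℝ (Fin d)) (hμ : μ = ∫ ω, X ω ∂P)
    (K : ℕ) (hK : 0 < K)
    (R : Set (ℝ × EuclideanSpace ℝ (Fin d))) (hR : ∀ p ∈ R, 0 ≤ p.1)
    (hconv : Convex ℝ (closure R))
    (hzero : ((0 : ℝ), (0 : EuclideanSpace ℝ (Fin d))) ∈ closure R)
    (m : ℝ) (hm : 0 < m) (hbd : (m, m • μ) ∈ frontier R)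
    (hunique : ∀ t : ℝ, 0 < t → (t, t • μ) ∈ frontier R → t = m)
    (A : EuclideanSpace ℝ (Fin d)) (B C : ℝ) (hC : 0 < C)
    (hsupp : IsSupportingHyperplaneAt R A B C (m, m • μ))
    (Z : Ω → ℝ) (hZ : ∀ ω, Z ω = B * K + inner ℝ A (∑ i ∈ Finset.range K, ξ i ω)) :
    -- (I)
    ((∫⁻ ω, (exitTime K R ξ ω : ℝ≥0∞) ∂P
        ≤ ENNReal.ofReal (m + 1 / K * (m / C) ^ 2 * ∫ ω, (max 0 (Z ω)) ^ 2 ∂P)) ∧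
      (m + 1 / K * (m / C) ^ 2 * ∫ ω, (max 0 (Z ω)) ^ 2 ∂P
        ≤ m + K + (m / C) ^ 2 * ∫ ω, (inner ℝ A (X ω - μ)) ^ 2 ∂P) ∧
      (m + K + (m / C) ^ 2 * ∫ ω, (inner ℝ A (X ω - μ)) ^ 2 ∂P
        ≤ m + K + (m / C) ^ 2 * (‖A‖ ^ 2 * ∫ ω, ‖X ω - μ‖ ^ 2 ∂P))) ∧
    -- (II)
    (iIndepFun (fun (j : Fin d) (ω : Ω) => X ω j) P →
      ∫⁻ ω, (exitTime K R ξ ω : ℝ≥0∞) ∂P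
        ≤ ENNReal.ofReal
            (m + K + (m / C) ^ 2 * ∑ j, (A j) ^ 2 * ∫ ω, (X ω j - μ j) ^ 2 ∂P)) ∧
    -- (III)
    (∀ a b : EuclideanSpace ℝ (Fin d), (∀ᵐ ω ∂P, ∀ j, a j ≤ X ω j ∧ X ω j ≤ b j) →
      ∀ u v : ℝ,
        u = 1 / 2 * (∑ j, A j * (a j + b j) + ∑ j, |A j| * (a j - b j)) + B →
        v = 1 / 2 * (∑ j, A j * (a j + b j) + ∑ j, |A j| * (b j - a j)) + B →
        (∫⁻ ω, (exitTime K R ξ ω : ℝ≥0∞) ∂P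
          ≤ ENNReal.ofReal (m + K * m * (u + v) / C - K * m ^ 2 * u * v / C ^ 2)) ∧
        (u < 0 → ∫⁻ ω, (exitTime K R ξ ω : ℝ≥0∞) ∂P
          ≤ ENNReal.ofReal (m + K * v ^ 2 / (v - u) * (m / C) ^ 2 * (C / m - u)))) := by
  obtain ⟨-, -, hpt, hside⟩ := hsupp
  have hside : ∀ q ∈ R, inner ℝ A q.2 + B * q.1 ≤ C := by
    rcases hside with h | h
    · exact h
    -- If `R` were on the other side, so would be its closure, and the origin would give `C ≤ 0`.
    · have hcl : IsClosed {q : ℝ × EuclideanSpace ℝ (Fin d) | C ≤ inner ℝ A q.2 + B * q.1} :=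
        isClosed_le continuous_const (by fun_prop)
      have h0 : C ≤ inner ℝ A (0 : EuclideanSpace ℝ (Fin d)) + B * (0 : ℝ) :=
        closure_minimal h hcl hzero
      simp only [inner_zero_right, mul_zero, add_zero] at h0
      linarith
  have hXm : AEMeasurable X P := (hident 0).aemeasurable_snd
  have hXj : ∀ j, AEMeasurable (fun ω => X ω j) P := fun j =>
    (by fun_prop : Measurable fun x : EuclideanSpace ℝ (Fin d) => x j).comp_aemeasurable hXm
  have hX : MemLp X 2 P := memLp_piLp_iff.2 fun j =>
    (memLp_two_iff_integrable_sq (hXj j).aestronglyMeasurable).2 (by simpa using hsq j)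
  have hXi : Integrable X P := hX.integrable one_le_two
  have hKpos : (0 : ℝ) < K := by exact_mod_cast hK
  set W : Ω → ℝ := fun ω => inner ℝ A (X ω) + B
  set Y : ℕ → Ω → ℝ := fun i ω => inner ℝ A (ξ i ω) + B
  have hg : Measurable fun x : EuclideanSpace ℝ (Fin d) => inner ℝ A x + B := by fun_prop
  have hYW : ∀ i, IdentDistrib (Y i) W P P := fun i => (hident i).comp hg
  have hYind : iIndepFun Y P := hindep.comp (fun _ x => inner ℝ A x + B) fun _ => hg
  have hAX : MemLp (fun ω => inner ℝ A (X ω)) 2 P := hX.const_inner A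
  have hW : MemLp W 2 P := hAX.add (memLp_const B)
  have hAmean : ∫ ω, inner ℝ A (X ω) ∂P = inner ℝ A μ := by rw [hμ, integral_inner hXi]
  have hWmean : ∫ ω, W ω ∂P = C / m := by
    have h : m * (inner ℝ A μ + B) = C := by
      rw [← hpt, real_inner_smul_right]
      ring
    rw [integral_add (hAX.integrable one_le_two) (integrable_const B), hAmean, ← h]
    simp [hm.ne']
  have hAvar : Var[fun ω => inner ℝ A (X ω); P] = ∫ ω, (inner ℝ A (X ω - μ)) ^ 2 ∂P := by
    rw [variance_eq_integral hAX.1.aemeasurable, hAmean]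
    simp_rw [inner_sub_right]
  have hWvar : Var[W; P] = ∫ ω, (inner ℝ A (X ω - μ)) ^ 2 ∂P := by
    rw [← hAvar]
    exact variance_add_const hAX.1 B
  have hZsum : ∀ ω, Z ω = ∑ i ∈ Finset.range K, (inner ℝ A (ξ i ω) + B) := fun ω => by
    rw [hZ, inner_sum, Finset.sum_add_distrib]
    simp only [Finset.sum_const, Finset.card_range, nsmul_eq_mul]
    ring
  have hZY : Z = ∑ i ∈ Finset.range K, Y i := by
    ext ω
    rw [hZsum, Finset.sum_apply]
  have hZ2 : MemLp Z 2 P := hZY ▸ memLp_iidSum hYW hW K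
  have hZmean : ∫ ω, Z ω ∂P = K * (C / m) := by
    rw [hZY, integral_iidSum hYW (hW.integrable one_le_two), hWmean]
  have hZvar : Var[Z; P] = K * ∫ ω, (inner ℝ A (X ω - μ)) ^ 2 ∂P := by
    rw [hZY, variance_iidSum hYW hYind hW, hWvar]
  have hfac : 0 ≤ 1 / K * (m / C) ^ 2 := by positivity
  have hlorden : ∫⁻ ω, (exitTime K R ξ ω : ℝ≥0∞) ∂P
      ≤ ENNReal.ofReal (m + 1 / K * (m / C) ^ 2 * ∫ ω, (max 0 (Z ω)) ^ 2 ∂P) := by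
    refine (lintegral_exitTime_le hindep hident hK hC.le hside hZsum hZ2
      (by rw [hZmean]; positivity)).trans_eq ?_
    rw [hZmean]
    congr 1
    field_simp
  have hvar : m + 1 / K * (m / C) ^ 2 * ∫ ω, (max 0 (Z ω)) ^ 2 ∂P
      ≤ m + K + (m / C) ^ 2 * ∫ ω, (inner ℝ A (X ω - μ)) ^ 2 ∂P := by
    have h := mul_le_mul_of_nonneg_left (integral_posPart_sq_le hZ2) hfac
    rw [hZvar, hZmean] at h
    -- The squared mean of `Z` produces the summand `K`, its variance the remaining one.
    have e : ∀ V : ℝ, 1 / K * (m / C) ^ 2 * (K * V + (K * (C / m)) ^ 2) =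
        K + (m / C) ^ 2 * V := fun V => by
      field_simp
      ring
    rw [e] at h
    linarith
  refine ⟨⟨hlorden, hvar, ?_⟩, fun hcomp => ?_, fun a b hab u v hu hv => ?_⟩
  · have := integral_inner_sub_sq_le hX A μ
    gcongr
  · refine (hlorden.trans (ENNReal.ofReal_le_ofReal hvar)).trans_eq ?_
    rw [← hAvar, variance_inner_of_iIndepFun hX hcomp]
    congr 3
    refine Finset.sum_congr rfl fun j _ => ?_
    rw [variance_eq_integral (hXj j), hμ,
      eval_integral_piLp fun i => (memLp_piLp_iff.1 hX i).integrable one_le_two]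
  · have hWuv : ∀ᵐ ω ∂P, W ω ∈ Set.Icc u v := by
      filter_upwards [hab] with ω hω
      rw [hu, hv]
      exact inner_add_mem_Icc_of_mem_box A (X ω) a b B hω
    have hZuv : ∀ᵐ ω ∂P, Z ω ∈ Set.Icc (K * u) (K * v) := hZY ▸ iidSum_mem_Icc hYW hWuv K
    refine ⟨hlorden.trans (ENNReal.ofReal_le_ofReal ?_),
      fun hu0 => hlorden.trans (ENNReal.ofReal_le_ofReal ?_)⟩
    · have h := mul_le_mul_of_nonneg_left (integral_posPart_sq_le_of_mem_Icc hZ2 hZuv) hfac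
      rw [hZmean] at h
      have e : 1 / K * (m / C) ^ 2 * ((K * u + K * v) * (K * (C / m)) - K * u * (K * v)) =
          K * m * (u + v) / C - K * m ^ 2 * u * v / C ^ 2 := by
        field_simp
      rw [e] at h
      linarith
    -- The chord bound needs a positive right endpoint: `v` is at least the mean `C / m` of `W`.
    · have hvpos : 0 < v := by
        have h : C / m ≤ v := by
          rw [← hWmean]
          simpa using integral_mono_ae (hW.integrable one_le_two) (integrable_const v)
            (hWuv.mono fun ω hω => hω.2)
        exact (div_pos hC hm).trans_le h
      have h := mul_le_mul_of_nonneg_left (integral_posPart_sq_le_of_mem_Icc_of_neg hZ2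
        (mul_neg_of_pos_of_neg hKpos hu0) (mul_pos hKpos hvpos) hZuv) hfac
      rw [hZmean] at h
      have hvu : v - u ≠ 0 := by linarith
      have e : 1 / K * (m / C) ^ 2 *
          ((K * v) ^ 2 / (K * v - K * u) * (K * (C / m) - K * u)) =
          K * v ^ 2 / (v - u) * (m / C) ^ 2 * (C / m - u) := by
        rw [← mul_sub, ← mul_sub]
        field_simp
      rw [e] at h
      linarith
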